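/- Let $q$ be a power of a prime $p$, let $m\ge 1$, let $\mathbb{F}=\mathbb{F}_{q^2}$, and let $V=\mathbb{F}^{2m}$, with $x_1,\ldots,x_{2m}$ the basis of $V^*$ dual to the standard basis. For a matrix $N=(a_{ij})$ over $\mathbb{F}$ write $\bar N=(a_{ij}^q)$, and let $J$ be the $2m\times 2m$ antidiagonal matrix with entries $J_{ij}=1$ if $i+j=2m+1$ and $J_{ij}=0$ otherwise. Let $G$ be the group of all lower triangular $2m\times 2m$ matrices $N$ over $\mathbb{F}$ with ones on the diagonal such that $N^{T}J\bar N=J$ (this is a Sylow $p$-subgroup of the unitary group $GU(2m,q^2)=\{N\in GL_{2m}(\mathbb{F}) : N^TJ\bar N=J\}$). The group $G$ acts on $\mathbb{F}[V]=\mathbb{F}[x_1,\ldots,x_{2m}]$ by $(g\cdot f)(v)=f(g^{-1}v)$, and on its fraction field $\mathbb{F}(V)$. Let $N(x_i)=\prod_{y\in G\cdot x_i}y$ be the product of the distinct elements of the $G$-orbit of $x_i$, and for $k\ge 1$ let $$h_k=\sum_{i=1}^{m}\left(x_{2m-i+1}^{\,q^{2k-1}}x_i+x_{2m-i+1}x_i^{\,q^{2k-1}}\right).$$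 Then the field of $G$-invariant rational functions is $$\mathbb{F}_{q^2}(V)^G=\mathbb{F}_{q^2}\bigl(x_1,N(x_2),\ldots,N(x_{m+1}),h_1,\ldots,h_{m-1}\bigr).$$ -/

import Mathlib

noncomputable section

namespace SylowGU

open MvPolynomial

variable (F : Type*) [Field F]

/-- The group `U(n, F)` of lower triangular matrices over `F` with ones on the diagonal. -/
def lowerUnitriangular (n : ℕ) : Subgroup (GL (Fin n) F) where
  carrier := {g | (∀ i, g.1 i i = 1) ∧ ∀ i j, i < j → g.1 i j = 0}
  one_mem' := ⟨fun i => by simp, fun i j h => by simp [h.ne]⟩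
  mul_mem' := by
    rintro a b ⟨ha, ha'⟩ ⟨hb, hb'⟩
    refine ⟨fun i => ?_, fun i j h => ?_⟩
    · rw [Units.val_mul, Matrix.mul_apply, Finset.sum_eq_single i]
      · rw [ha, hb, one_mul]
      · intro k _ hk
        rcases lt_or_gt_of_ne hk with h | h
        · rw [hb' k i h, mul_zero]
        · rw [ha' i k h, zero_mul]
      · simp
    · rw [Units.val_mul, Matrix.mul_apply]
      refine Finset.sum_eq_zero fun k _ => ?_
      rcases lt_or_ge i k with hk | hk
      · rw [ha' i k hk, zero_mul]
      · rw [hb' k j (hk.trans_lt h), mul_zero]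
  inv_mem' := by
    rintro a ⟨ha, ha'⟩
    have hinv : ∀ i j, i < j → (a⁻¹).1 i j = 0 := by
      intro i j h
      have hb : Matrix.BlockTriangular a.1 (OrderDual.toDual : Fin n → (Fin n)ᵒᵈ) :=
        fun i j h => ha' i j h
      let _ : Invertible a.1 := a.invertible
      have := Matrix.blockTriangular_inv_of_blockTriangular hb
      rw [Matrix.coe_units_inv]
      exact this h
    refine ⟨fun i => ?_, hinv⟩
    have h1 : (a * a⁻¹).1 i i = 1 := by simp
    rw [Units.val_mul, Matrix.mul_apply, Finset.sum_eq_single i] at h1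
    · rwa [ha, one_mul] at h1
    · intro k _ hk
      rcases lt_or_gt_of_ne hk with h | h
      · rw [hinv k i h, mul_zero]
      · rw [ha' i k h, zero_mul]
    · simp

/-- The antidiagonal `n × n` matrix `J_n`. For `n = 2 m`, it is the block matrix with `J_{m-1}`,
`J_2`, `J_{m-1}` along the block antidiagonal. -/
def antidiag (n : ℕ) : Matrix (Fin n) (Fin n) F :=
  Matrix.of fun i j => if j = i.rev then 1 else 0

variable (p e : ℕ) [Fact p.Prime] [CharP F p]

/-- The matrix `Ā`, obtained by raising every entry of `A` to the power `q = p ^ e`. -/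
def bar {n : ℕ} (A : Matrix (Fin n) (Fin n) F) : Matrix (Fin n) (Fin n) F :=
  A.map fun a => a ^ p ^ e

theorem bar_eq {n : ℕ} (A : Matrix (Fin n) (Fin n) F) :
    bar F p e A = (iterateFrobenius F p e).mapMatrix A := rfl

/-- The general unitary group `GU(n, q²)`, `q = p ^ e`, of the hermitian form with matrix `J_n`
(to be used for a field `F` with `q²` elements). -/
def generalUnitary (n : ℕ) : Subgroup (GL (Fin n) F) where
  carrier := {g | g.1.transpose * antidiag F n * bar F p e g.1 = antidiag F n}
  one_mem' := by simp [bar_eq]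
  mul_mem' := by
    intro a b ha hb
    simp only [Set.mem_ofPred_eq, bar_eq] at ha hb ⊢
    rw [Units.val_mul, Matrix.transpose_mul, map_mul]
    calc _ = b.1.transpose * (a.1.transpose * antidiag F n * (iterateFrobenius F p e).mapMatrix a.1)
          * (iterateFrobenius F p e).mapMatrix b.1 := by simp only [mul_assoc]
      _ = _ := by rw [ha, hb]
  inv_mem' := by
    intro a ha
    simp only [Set.mem_ofPred_eq, bar_eq] at ha ⊢
    have h1 : (a⁻¹).1.transpose * a.1.transpose = 1 := by
      rw [← Matrix.transpose_mul, ← Units.val_mul]; simp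
    have h2 : (iterateFrobenius F p e).mapMatrix a.1 *
        (iterateFrobenius F p e).mapMatrix (a⁻¹).1 = 1 := by
      rw [← map_mul, ← Units.val_mul]; simp
    calc _ = (a⁻¹).1.transpose * (a.1.transpose * antidiag F n *
            (iterateFrobenius F p e).mapMatrix a.1) * (iterateFrobenius F p e).mapMatrix (a⁻¹).1 := by
          rw [ha]
      _ = ((a⁻¹).1.transpose * a.1.transpose) * antidiag F n *
            ((iterateFrobenius F p e).mapMatrix a.1 *
              (iterateFrobenius F p e).mapMatrix (a⁻¹).1) := by simp only [mul_assoc]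
      _ = _ := by rw [h1, h2, one_mul, mul_one]

/-- The group of lower unitriangular matrices `N` of size `2 m` with `Nᵀ J N̄ = J`. -/
def sylow (m : ℕ) : Subgroup (GL (Fin (2 * m)) F) :=
  lowerUnitriangular F (2 * m) ⊓ generalUnitary F p e (2 * m)

/-- The substitution `(g • f)(v) = f (g⁻¹ v)` as an endomorphism of the algebra
`F[V] = F[x_1, …, x_n]`; on variables it is `x_i ↦ ∑ j, (g⁻¹)_{i j} x_j`. -/
def polySubst {n : ℕ} (g : GL (Fin n) F) :
    MvPolynomial (Fin n) F →ₐ[F] MvPolynomial (Fin n) F :=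
  aeval fun i => ∑ j, C ((g⁻¹).1 i j) * X j

theorem polySubst_one {n : ℕ} : polySubst F (1 : GL (Fin n) F) = AlgHom.id F _ := by
  ext1 i
  simp [polySubst, Matrix.one_apply]

theorem polySubst_mul {n : ℕ} (g h : GL (Fin n) F) :
    polySubst F (g * h) = (polySubst F g).comp (polySubst F h) := by
  ext1 i
  simp only [polySubst, AlgHom.comp_apply, aeval_X, map_sum, map_mul, mul_inv_rev, Units.val_mul,
    Matrix.mul_apply, Finset.sum_mul, Finset.mul_sum, algHom_C, algebraMap_eq]
  rw [Finset.sum_comm]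
  simp only [mul_assoc]

/-- The action of `GL(V)` on `F[V]` by algebra automorphisms, `(g • f)(v) = f (g⁻¹ v)`. -/
def polyAction (n : ℕ) :
    GL (Fin n) F →* (MvPolynomial (Fin n) F ≃ₐ[F] MvPolynomial (Fin n) F) where
  toFun g := AlgEquiv.ofAlgHom (polySubst F g) (polySubst F g⁻¹)
    (by rw [← polySubst_mul, mul_inv_cancel, polySubst_one])
    (by rw [← polySubst_mul, inv_mul_cancel, polySubst_one])
  map_one' := by ext f; simp [polySubst_one]
  map_mul' g h := by ext f; simp [polySubst_mul]

/-- The field of rational functions `F(V) = F(x_1, …, x_n)`. -/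
abbrev RatFunc (n : ℕ) : Type _ := FractionRing (MvPolynomial (Fin n) F)

/-- The action of `GL(V)` on `F(V)` by field automorphisms that extends the action on `F[V]`. -/
def fieldAction (n : ℕ) : GL (Fin n) F →* (RatFunc F n ≃ₐ[F] RatFunc F n) :=
  (IsFractionRing.fieldEquivOfAlgEquivHom (A := F) (B := MvPolynomial (Fin n) F)
    F (RatFunc F n)).comp (polyAction F n)

variable {F}

/-- The invariant field `F(V)^G`. -/
def invariantField {n : ℕ} (G : Subgroup (GL (Fin n) F)) : IntermediateField F (RatFunc F n) :=
  IntermediateField.fixedField (G.map (fieldAction F n))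

/-- The orbit product of a polynomial `f`: the product of the distinct elements of its orbit
under `G` (the orbit is finite when `G` is). -/
def orbitProduct {n : ℕ} (G : Subgroup (GL (Fin n) F)) (f : MvPolynomial (Fin n) F) :
    MvPolynomial (Fin n) F :=
  ∏ᶠ y ∈ {y | ∃ g ∈ G, polyAction F n g f = y}, y

variable (F)

/-- `h_k = ∑_{i=1}^m (x_{2m-i+1}^{q^{2k-1}} x_i + x_{2m-i+1} x_i^{q^{2k-1}})` for `k ≥ 1`. The
variable `x_i` is `X` of the index `i - 1` of `Fin (2 * m)`, and `Fin.rev` takes the index of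
`x_i` to that of `x_{2m-i+1}`. -/
def h (q m k : ℕ) : MvPolynomial (Fin (2 * m)) F :=
  ∑ i : Fin m,
    (X (Fin.castLE (by omega) i).rev ^ q ^ (2 * k - 1) * X (Fin.castLE (by omega) i) +
      X (Fin.castLE (by omega) i).rev * X (Fin.castLE (by omega) i) ^ q ^ (2 * k - 1))

end SylowGU

end

/-!
Write `K` for the field generated by `x_1`, the orbit products `N(x_2), …, N(x_{m+1})` and the forms
`h_1, …, h_{m-1}`, write `E = F(V)`, and let `φ` be the `q`-Frobenius. All generators are invariant,
so it has to be shown that every invariant lies in `K`. For this it is enough that `E / K` is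
separable algebraic and that every `K`-embedding `τ` of `E` into an algebraic closure of `E` is the
action of an element of the Sylow group (`invariantField_le`, `mem_of_forall_algHom_eq`).

The orbit of `x_j`, `j ≤ m + 1`, is `x_j + W`, where `W` is a finite additive group of linear forms in
the earlier variables (`orbitProduct_X`, by explicit unitary matrices). A polynomial `∏ (T + w)`,
`w ∈ W`, takes the same value at two points only if they differ by an element of `W`, and its
derivative vanishes nowhere on `x_j + W`.

* Embeddings (`exists_mem_sylow_of_generators_eq`). As `τ` fixes the orbit products, it acts on
  `x_1, …, x_m` by a lower unitriangular matrix and moves `x_{m+1}` by an element of `W`. After a change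
  of coordinates, the invariance of the `h_k` says that the remaining differences `d_j` satisfy
  `∑ (φ^{2k-1}(d_j) x_j + d_j φ^{2k-1}(x_j)) = 0` for `k = 1, …, n`, where `n = m - 1` is the number of
  unknowns. Such `d_j` lie in the `F`-span of the `x_j` (`mem_span_of_skew_system`): if
  `φ^{2n}(x) = ∑ c_k φ^{2k}(x)`, the equations give the same relation for `d`, and the polynomial
  `T^{|F|^n} - ∑ c_k T^{|F|^k}` has no roots outside the span of the `x_j`. So `τ` is given by a matrix
  over `F`, which is unitary because `h_1` is preserved, and lower unitriangular because it is unitary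
  and its first `m + 1` rows have that shape. For `m = 1`, where there is no `h_1`, the orbit products
  already give a matrix of the group.
* Separability (`isSeparable_of_derivation`, `derivation_eq_zero_of_generators`). A derivation of `E`
  that vanishes on `K` kills `x_1, …, x_{m+1}` by the orbit products, and applied to `h_1, …, h_{m-1}` it
  gives a linear system for the values at the other variables whose matrix is a Moore matrix of
  linearly independent elements, hence invertible (`moore_isUnit`).
-/

namespace SylowGU

/-! ### Additive polynomials and Moore matrices -/

section Moore

open Polynomial

variable {F L : Type*} [Field F] [Field L]

/-- The additive polynomial `∑ a_k T ^ |F| ^ k`. -/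
noncomputable def linearized (F : Type*) {L : Type*} [Field F] [Field L] {n : ℕ}
    (a : Fin n → L) : L[X] :=
  ∑ k, C (a k) * X ^ Nat.card F ^ (k : ℕ)

theorem linearized_eval {n : ℕ} (a : Fin n → L) (x : L) :
    (linearized F a).eval x = ∑ k, a k * x ^ Nat.card F ^ (k : ℕ) := by
  simp [linearized, eval_finsetSum]

variable [Finite F]

theorem linearized_natDegree_lt {n : ℕ} (a : Fin n → L) :
    (linearized F a).natDegree < Nat.card F ^ n := by
  have h1 : 1 < Nat.card F := Finite.one_lt_card
  have hpos : 0 < Nat.card F ^ n := by positivity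
  refine lt_of_le_of_lt (natDegree_sum_le_of_forall_le (n := Nat.card F ^ n - 1) _ _
    fun k _ => (natDegree_C_mul_X_pow_le _ _).trans ?_) (by omega)
  have := Nat.pow_lt_pow_right h1 k.2
  omega

theorem linearized_coeff {n : ℕ} (a : Fin n → L) (k : Fin n) :
    (linearized F a).coeff (Nat.card F ^ (k : ℕ)) = a k := by
  have h1 : 1 < Nat.card F := Finite.one_lt_card
  rw [linearized, finsetSum_coeff, Finset.sum_eq_single k]
  · simp
  · intro j _ hj
    rw [coeff_C_mul, coeff_X_pow, if_neg, mul_zero]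
    exact fun h => hj (Fin.ext (Nat.pow_right_injective h1 h).symm)
  · simp

variable [Algebra F L]

/-- A nonzero polynomial that vanishes on an `n`-dimensional space over `F` has degree at least
`|F| ^ n`; if the degree is not larger, it has no other roots. -/
theorem card_span_le_natDegree {n : ℕ} {v : Fin n → L} (hv : LinearIndependent F v) {P : L[X]}
    (hP : P ≠ 0) (hroot : ∀ w ∈ Submodule.span F (Set.range v), P.eval w = 0) :
    Nat.card F ^ n ≤ P.natDegree ∧
      ∀ d, P.eval d = 0 → P.natDegree ≤ Nat.card F ^ n → d ∈ Submodule.span F (Set.range v) := by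
  classical
  set S := Submodule.span F (Set.range v)
  have : Module.Finite F S := FiniteDimensional.span_of_finite F (Set.finite_range v)
  have hfin : Finite S := Module.finite_of_finite F
  have hcard : Nat.card S = Nat.card F ^ n := by
    rw [Module.natCard_eq_pow_finrank (K := F), finrank_span_eq_card hv, Fintype.card_fin]
  have hSf : (S : Set L).Finite := Set.toFinite _
  have hsub : hSf.toFinset ⊆ P.roots.toFinset := fun w hw => by
    simpa [hP] using hroot w (by simpa using hw)
  have hc : hSf.toFinset.card = Nat.card F ^ n := by
    rw [← hcard]; exact (Nat.card_eq_card_finite_toFinset hSf).symm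
  have hdeg : P.roots.toFinset.card ≤ P.natDegree :=
    (Multiset.toFinset_card_le _).trans (card_roots' P)
  refine ⟨hc ▸ (Finset.card_le_card hsub).trans hdeg, fun d hd hn => ?_⟩
  have heq := Finset.eq_of_subset_of_card_le hsub (by omega)
  have : d ∈ P.roots.toFinset := by simp [hP, hd]
  simpa [← heq] using this

/-- The map `x ↦ x ^ |F| ^ k` is linear over the finite field `F`. -/
noncomputable def frobPow (F L : Type*) [Field F] [Finite F] [Field L] [Algebra F L] (k : ℕ) :
    L →ₗ[F] L :=
  have := Fintype.ofFinite F
  ((FiniteField.frobeniusAlgHom F L) ^ k).toLinearMap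

theorem frobPow_apply (k : ℕ) (x : L) : frobPow F L k x = x ^ Nat.card F ^ k := by
  have := Fintype.ofFinite F
  induction k generalizing x with
  | zero => simp [frobPow]
  | succ k ih =>
    simp only [frobPow, AlgHom.toLinearMap_apply, pow_succ, AlgHom.mul_apply] at ih ⊢
    rw [ih, FiniteField.frobeniusAlgHom_apply, ← pow_mul, Fintype.card_eq_nat_card, mul_comm]

/-- Evaluation of an additive polynomial is an `F`-linear map. -/
theorem linearized_eval_eq_frobPow {n : ℕ} (a : Fin n → L) (x : L) :
    (linearized F a).eval x = (∑ k, a k • frobPow F L k : L →ₗ[F] L) x := by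
  simp [linearized, eval_finsetSum, frobPow_apply]

/-- The Moore matrix of a family that is linearly independent over `F` is invertible: a relation
between its rows is an additive polynomial of too small a degree that vanishes on the span. -/
theorem moore_isUnit {n : ℕ} {v : Fin n → L} (hv : LinearIndependent F v) :
    IsUnit (Matrix.of fun k j : Fin n => v j ^ Nat.card F ^ (k : ℕ)) := by
  rw [Matrix.isUnit_iff_isUnit_det, isUnit_iff_ne_zero]
  intro h0
  obtain ⟨a, ha, h⟩ := Matrix.exists_vecMul_eq_zero_iff.mpr h0
  have hP : linearized F a ≠ 0 := fun h => ha (funext fun k => by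
    rw [← linearized_coeff (F := F) a k, h]; simp)
  refine absurd (card_span_le_natDegree hv hP fun w hw => ?_).1 (linearized_natDegree_lt a).not_ge
  rw [linearized_eval_eq_frobPow]
  suffices Submodule.span F (Set.range v) ≤
    LinearMap.ker (∑ k, a k • frobPow F L k : L →ₗ[F] L) from this hw
  rw [Submodule.span_le]
  rintro _ ⟨j, rfl⟩
  have := congrFun h j
  simpa [Matrix.vecMul, dotProduct, frobPow_apply] using this

theorem eq_zero_of_sum_mul_pow_eq_zero {n : ℕ} {v : Fin n → L} (hv : LinearIndependent F v)
    {c : Fin n → L} (h : ∀ k : Fin n, ∑ j, c j * v j ^ Nat.card F ^ (k : ℕ) = 0) : c = 0 := by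
  have := Matrix.mulVec_injective_of_isUnit (moore_isUnit hv)
  apply this
  ext k
  simpa [Matrix.mulVec, dotProduct, mul_comm] using h k

theorem exists_pow_card_eq_sum {n : ℕ} {v : Fin n → L} (hv : LinearIndependent F v) :
    ∃ c : Fin n → L, ∀ j, v j ^ Nat.card F ^ n = ∑ k, c k * v j ^ Nat.card F ^ (k : ℕ) := by
  obtain ⟨c, hc⟩ := Matrix.vecMul_surjective_iff_isUnit.mpr (moore_isUnit hv)
    fun j => v j ^ Nat.card F ^ n
  exact ⟨c, fun j => by rw [← congrFun hc j]; simp [Matrix.vecMul, dotProduct]⟩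

/-- An additive polynomial of degree `|F| ^ n` that vanishes on `n` linearly independent elements has
only the elements of their span as roots. -/
theorem mem_span_of_pow_card_eq_sum {n : ℕ} {v : Fin n → L} (hv : LinearIndependent F v)
    {c : Fin n → L} (hc : ∀ j, v j ^ Nat.card F ^ n = ∑ k, c k * v j ^ Nat.card F ^ (k : ℕ))
    {d : L} (hd : d ^ Nat.card F ^ n = ∑ k, c k * d ^ Nat.card F ^ (k : ℕ)) :
    d ∈ Submodule.span F (Set.range v) := by
  have hlt := linearized_natDegree_lt (F := F) c
  have hdeg : (X ^ Nat.card F ^ n - linearized F c).natDegree = Nat.card F ^ n := by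
    rw [natDegree_sub_eq_left_of_natDegree_lt] <;> simp [hlt]
  have hpos : 0 < Nat.card F ^ n := by have : 0 < Nat.card F := Nat.card_pos; positivity
  refine (card_span_le_natDegree hv (P := X ^ Nat.card F ^ n - linearized F c) ?_ ?_).2 d ?_ hdeg.le
  · intro h; rw [h] at hdeg; simp at hdeg; omega
  · intro w hw
    rw [eval_sub, linearized_eval_eq_frobPow, eval_pow, eval_X, ← frobPow_apply, ← LinearMap.sub_apply]
    suffices Submodule.span F (Set.range v) ≤
      LinearMap.ker (frobPow F L n - ∑ k, c k • frobPow F L k : L →ₗ[F] L) from this hw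
    rw [Submodule.span_le]
    rintro _ ⟨j, rfl⟩
    simp [frobPow_apply, hc j]
  · rw [eval_sub, linearized_eval, eval_pow, eval_X, hd, sub_self]

end Moore

/-! ### Skew-hermitian systems of Frobenius equations -/

section SkewForm

variable {F L : Type*} [Field F] [Finite F] {p e : ℕ}

theorem pow_even_frobenius (hF : Nat.card F = (p ^ e) ^ 2) (a : F) (k : ℕ) :
    a ^ (p ^ e) ^ (2 * k) = a := by
  have := Fintype.ofFinite F
  rw [pow_mul, ← hF, ← Fintype.card_eq_nat_card, FiniteField.pow_card_pow]

theorem pow_odd_frobenius (hF : Nat.card F = (p ^ e) ^ 2) (a : F) {k : ℕ} (hk : 1 ≤ k) :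
    a ^ (p ^ e) ^ (2 * k - 1) = a ^ p ^ e := by
  obtain ⟨k, rfl⟩ := Nat.exists_eq_add_of_le' hk
  rw [show 2 * (k + 1) - 1 = 2 * k + 1 by omega, pow_succ, pow_mul, pow_even_frobenius hF]

theorem bar_pow_odd_frobenius (hF : Nat.card F = (p ^ e) ^ 2) (a : F) {k : ℕ} (hk : 1 ≤ k) :
    (a ^ p ^ e) ^ (p ^ e) ^ (2 * k - 1) = a := by
  rw [← pow_mul, ← pow_succ', show 2 * k - 1 + 1 = 2 * k by omega, pow_even_frobenius hF]

theorem bar_bar (hF : Nat.card F = (p ^ e) ^ 2) (a : F) : (a ^ p ^ e) ^ p ^ e = a := by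
  simpa using bar_pow_odd_frobenius hF a le_rfl

variable [Fact p.Prime] [Field L] [CharP L p]

theorem sum_pow_frobenius {ι : Type*} (s : Finset ι) (f : ι → L) (k : ℕ) :
    (∑ i ∈ s, f i) ^ (p ^ e) ^ k = ∑ i ∈ s, f i ^ (p ^ e) ^ k := by
  rw [← pow_mul]; exact sum_pow_char_pow p _ s f

variable [Algebra F L]

theorem linearIndependent_frobenius (hF : Nat.card F = (p ^ e) ^ 2) {n : ℕ} {x : Fin n → L}
    (hx : LinearIndependent F x) : LinearIndependent F fun i => x i ^ p ^ e := by
  rw [Fintype.linearIndependent_iff] at hx ⊢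
  intro a ha i
  have hq : p ^ e ≠ 0 := pow_ne_zero _ (Fact.out : p.Prime).ne_zero
  have h0 : (∑ j, a j ^ p ^ e • x j) ^ (p ^ e) ^ 1 = 0 := by
    rw [sum_pow_frobenius, ← ha]
    exact Finset.sum_congr rfl fun j _ => by rw [smul_pow, pow_one, bar_bar hF]
  exact eq_zero_of_pow_eq_zero (hx (fun j => a j ^ p ^ e) (eq_zero_of_pow_eq_zero h0) i)

/-- Solutions of the skew-hermitian system lie in the span: the vector
`δ = φ^{2n} d - ∑ c_k φ^{2k} d`, where `φ` is the `q`-Frobenius and the `c_k` express `φ^{2n} x`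
through the `φ^{2k} x`, is orthogonal to the vectors `φ x, φ^3 x, …, φ^{2n-1} x`, which form a
basis, because the equations allow `d` and `x` to be exchanged in all products that occur. -/
theorem mem_span_of_skew_system (hF : Nat.card F = (p ^ e) ^ 2) {n : ℕ} {x d : Fin n → L}
    (hx : LinearIndependent F x)
    (h : ∀ k, 1 ≤ k → k ≤ n →
      ∑ j, (d j ^ (p ^ e) ^ (2 * k - 1) * x j + d j * x j ^ (p ^ e) ^ (2 * k - 1)) = 0) (j : Fin n) :
    d j ∈ Submodule.span F (Set.range x) := by
  have hcard (k : ℕ) : Nat.card F ^ k = (p ^ e) ^ (2 * k) := by rw [hF, pow_mul]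
  -- The `i`-th Frobenius power of an equation exchanges `d` and `x` in the products with exponents
  -- `i` and `i + (2 * k - 1)`.
  have hanti : ∀ i j k : ℕ, j = i + (2 * k - 1) → 1 ≤ k → k ≤ n →
      ∑ t, d t ^ (p ^ e) ^ j * x t ^ (p ^ e) ^ i = -∑ t, d t ^ (p ^ e) ^ i * x t ^ (p ^ e) ^ j := by
    rintro i j k rfl h1 h2
    have := congrArg (· ^ (p ^ e) ^ i) (h k h1 h2)
    have hz : (0 : L) ^ (p ^ e) ^ i = 0 :=
      zero_pow (pow_ne_zero _ (pow_ne_zero _ (Fact.out : p.Prime).ne_zero))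
    simp only [Finset.sum_add_distrib] at this
    simp only [← pow_mul p] at this hz
    rw [add_pow_char_pow, hz, sum_pow_char_pow, sum_pow_char_pow] at this
    rw [eq_neg_iff_add_eq_zero, ← this]
    simp only [mul_pow, ← pow_mul, ← pow_add, mul_add]
    congr 1 <;> refine Finset.sum_congr rfl fun t _ => ?_ <;>
    simp only [mul_comm, add_comm]
  obtain ⟨c, hc⟩ := exists_pow_card_eq_sum hx
  refine mem_span_of_pow_card_eq_sum hx hc ?_
  simp only [hcard] at hc ⊢
  have key : (fun t => d t ^ (p ^ e) ^ (2 * n) - ∑ k, c k * d t ^ (p ^ e) ^ (2 * (k : ℕ))) = 0 := by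
    refine eq_zero_of_sum_mul_pow_eq_zero (linearIndependent_frobenius hF hx) fun l => ?_
    have hl (t : Fin n) : (x t ^ p ^ e) ^ Nat.card F ^ (l : ℕ) = x t ^ (p ^ e) ^ (2 * (l : ℕ) + 1) := by
      rw [hcard, ← pow_mul, pow_succ' (p ^ e)]
    have hk (k : Fin n) : ∑ t, d t ^ (p ^ e) ^ (2 * (k : ℕ)) * x t ^ (p ^ e) ^ (2 * (l : ℕ) + 1) =
        -∑ t, d t ^ (p ^ e) ^ (2 * (l : ℕ) + 1) * x t ^ (p ^ e) ^ (2 * (k : ℕ)) := by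
      rcases le_or_gt (k : ℕ) l with hkl | hkl
      · rw [hanti (2 * k) (2 * l + 1) (l - k + 1) (by omega) (by omega) (by omega), neg_neg]
      · exact hanti (2 * l + 1) (2 * k) (k - l) (by omega) (by omega) (by omega)
    simp only [hl, sub_mul, Finset.sum_sub_distrib]
    rw [hanti (2 * l + 1) (2 * n) (n - l) (by omega) (by omega) (by omega)]
    simp only [hc, Finset.mul_sum, Finset.sum_mul]
    rw [Finset.sum_comm, Finset.sum_comm (γ := Fin n) (f := fun t k => _ * _ * _)]
    simp only [mul_left_comm _ (c _), mul_assoc, ← Finset.mul_sum, hk]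
    simp
  exact sub_eq_zero.mp (congrFun key j)

/-- Here `u`, `u'` stand for the two halves of the coordinates, `u'` in reversed order, and `v`, `v'`
for their conjugates. If `v = a u` with `a` lower unitriangular over `F`, the forms in `(v, v')` are
those in `(u, w)`, where `w` arises from `v'` by the conjugate transpose of `a`. The difference of
`w` and `u'`, corrected by the known last coefficients `b`, solves a skew-hermitian system. -/
theorem mem_span_of_forms_eq (hF : Nat.card F = (p ^ e) ^ 2) {n : ℕ} {u u' v v' : Fin (n + 1) → L}
    (hu : LinearIndependent F u) {a : Matrix (Fin (n + 1)) (Fin (n + 1)) F}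
    (ha1 : ∀ i, a i i = 1) (ha0 : ∀ i j, i < j → a i j = 0) (hv : ∀ i, v i = ∑ j, a i j • u j)
    {b : Fin (n + 1) → F} (hb : b (Fin.last n) + b (Fin.last n) ^ p ^ e = 0)
    (hv' : v' (Fin.last n) = u' (Fin.last n) + ∑ j, b j • u j)
    (h : ∀ k, 1 ≤ k → k ≤ n →
      ∑ j, (v' j ^ (p ^ e) ^ (2 * k - 1) * v j + v' j * v j ^ (p ^ e) ^ (2 * k - 1)) =
      ∑ j, (u' j ^ (p ^ e) ^ (2 * k - 1) * u j + u' j * u j ^ (p ^ e) ^ (2 * k - 1)))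
    (i : Fin (n + 1)) :
    v' i ∈ Submodule.span F (Set.range u ∪ Set.range u') := by
  set S := Submodule.span F (Set.range u ∪ Set.range u')
  have huS (j) : u j ∈ S := Submodule.subset_span (Or.inl ⟨j, rfl⟩)
  have hu'S (j) : u' j ∈ S := Submodule.subset_span (Or.inr ⟨j, rfl⟩)
  let w : Fin (n + 1) → L := fun j => ∑ i, a i j ^ p ^ e • v' i
  have hw (j) : w j = v' j + ∑ i ∈ Finset.Ioi j, a i j ^ p ^ e • v' i := by
    have hq : p ^ e ≠ 0 := pow_ne_zero _ (Fact.out : p.Prime).ne_zero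
    rw [← Finset.insert_erase (Finset.mem_univ j) |> fun h => show
      ∑ i ∈ insert j (Finset.univ.erase j), a i j ^ p ^ e • v' i = w j by rw [h],
      Finset.sum_insert (by simp), ha1, one_pow, one_smul]
    congr 1
    symm
    refine Finset.sum_subset (fun i hi => by simpa using (Finset.mem_Ioi.mp hi).ne') fun i h1 h2 => ?_
    have : i < j := lt_of_le_of_ne (by simpa using h2) (by simpa using h1)
    rw [ha0 i j this, zero_pow hq, zero_smul]
  have hwlast : w (Fin.last n) = u' (Fin.last n) + ∑ j, b j • u j := by
    rw [hw, ← hv', Finset.sum_eq_zero, add_zero]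
    intro i hi
    exact absurd (Finset.mem_Ioi.mp hi) (Fin.le_last i).not_gt
  -- Here `a ^ Q = a ^ q` and `(a ^ q) ^ Q = a` are used, for `Q` an odd power of `q` and `a` in `F`.
  have hform : ∀ k, 1 ≤ k →
      ∑ j, (v' j ^ (p ^ e) ^ (2 * k - 1) * v j + v' j * v j ^ (p ^ e) ^ (2 * k - 1)) =
      ∑ j, (w j ^ (p ^ e) ^ (2 * k - 1) * u j + w j * u j ^ (p ^ e) ^ (2 * k - 1)) := by
    intro k hk
    simp only [hv, w, sum_pow_frobenius, smul_pow, Finset.sum_add_distrib, Finset.mul_sum,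
      Finset.sum_mul, pow_odd_frobenius hF _ hk, bar_bar hF, smul_mul_assoc,
      mul_smul_comm]
    congr 1 <;> rw [Finset.sum_comm]
  -- The terms with `b` cancel the contribution of the last index to the forms.
  let d : Fin n → L := fun j =>
    w j.castSucc - u' j.castSucc + b j.castSucc ^ p ^ e • u (Fin.last n)
  have hd (j) : d j ∈ Submodule.span F (Set.range fun j : Fin n => u j.castSucc) := by
    refine mem_span_of_skew_system hF (hu.comp _ (Fin.castSucc_injective n)) (fun k h1 h2 => ?_) j
    have h3 := (hform k h1).symm.trans (h k h1 h2)
    have hadd (s t : L) : (s + t) ^ (p ^ e) ^ (2 * k - 1) =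
      s ^ (p ^ e) ^ (2 * k - 1) + t ^ (p ^ e) ^ (2 * k - 1) := by
      rw [← pow_mul]; exact add_pow_char_pow ..
    have hsub (s t : L) : (s - t) ^ (p ^ e) ^ (2 * k - 1) =
      s ^ (p ^ e) ^ (2 * k - 1) - t ^ (p ^ e) ^ (2 * k - 1) := by
      rw [← pow_mul]; exact sub_pow_char_pow ..
    simp only [Fin.sum_univ_castSucc, hwlast, hadd, sum_pow_frobenius, smul_pow,
      pow_odd_frobenius hF _ h1] at h3
    simp only [d, Function.comp_apply, hadd, hsub, smul_pow, bar_pow_odd_frobenius hF _ h1]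
    have hb' : b (Fin.last n) ^ p ^ e = - b (Fin.last n) := by linear_combination hb
    rw [hb'] at h3
    rw [← sub_eq_zero] at h3
    refine .trans ?_ h3
    simp only [Finset.sum_add_distrib, add_mul, sub_mul, Finset.sum_sub_distrib,
      Finset.sum_mul, smul_mul_assoc, neg_smul]
    simp only [Algebra.smul_def]
    simp only [mul_comm]
    ring
  have hwS (j) : w j ∈ S := by
    induction j using Fin.lastCases with
    | last =>
      rw [hwlast]
      exact S.add_mem (hu'S _) (S.sum_mem fun j _ => S.smul_mem _ (huS _))
    | cast j =>
      have h1 : d j ∈ S := Submodule.span_mono (by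
        rintro _ ⟨i, rfl⟩
        exact Or.inl ⟨_, rfl⟩) (hd j)
      have : w j.castSucc = d j + u' j.castSucc - b j.castSucc ^ p ^ e • u (Fin.last n) := by
        simp only [d]; ring
      rw [this]
      exact S.sub_mem (S.add_mem h1 (hu'S _)) (S.smul_mem _ (huS _))
  induction i using WellFoundedGT.induction with
  | ind i ih =>
    have : v' i = w i - ∑ j ∈ Finset.Ioi i, a j i ^ p ^ e • v' j := by rw [hw]; ring
    rw [this]
    exact S.sub_mem (hwS i) (S.sum_mem fun j hj => S.smul_mem _ (ih j (Finset.mem_Ioi.mp hj)))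

end SkewForm

/-! ### Unitary matrices and orbits of coordinates -/

section Matrices

variable {F : Type*} [Field F] {p e : ℕ}

theorem rev_ne_self {m : ℕ} (i : Fin (2 * m)) : i.rev ≠ i := fun h => by
  have := congrArg Fin.val h
  rw [Fin.val_rev] at this
  omega

theorem form_apply {n : ℕ} (N : Matrix (Fin n) (Fin n) F) (l r : Fin n) :
    (N.transpose * antidiag F n * bar F p e N) l r = ∑ i, N i l * N i.rev r ^ p ^ e := by
  simp only [Matrix.mul_apply, Matrix.transpose_apply, antidiag, Matrix.of_apply, bar,
    Matrix.map_apply, mul_ite, mul_one, mul_zero]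
  rw [← Equiv.sum_comp Fin.revPerm]
  refine Finset.sum_congr rfl fun i _ => ?_
  simp [Fin.rev_inj]

theorem eq_rev_comm {n : ℕ} {i j : Fin n} : i = j.rev ↔ j = i.rev := by
  rw [← Fin.rev_inj, Fin.rev_rev, eq_comm]

theorem mul_antidiag_apply {n : ℕ} (A : Matrix (Fin n) (Fin n) F) (i j : Fin n) :
    (A * antidiag F n) i j = A i j.rev := by
  rw [Matrix.mul_apply, Finset.sum_eq_single j.rev]
  · simp [antidiag]
  · intro k _ hk
    rw [antidiag, Matrix.of_apply, if_neg fun h => hk (eq_rev_comm.mp h), mul_zero]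
  · simp

theorem antidiag_mul_antidiag {n : ℕ} : antidiag F n * antidiag F n = 1 := by
  ext i j
  rw [mul_antidiag_apply]
  simp [antidiag, Matrix.one_apply, Fin.rev_inj, eq_comm]

variable [Fact p.Prime] [CharP F p]

/-- Rows of a unitary matrix satisfy the same relations as its columns. -/
theorem row_relation {n : ℕ} {N : GL (Fin n) F} (hN : N ∈ generalUnitary F p e n) (i j : Fin n) :
    ∑ l, N.1 i l * N.1 j l.rev ^ p ^ e = antidiag F n i j := by
  have hN : N.1.transpose * antidiag F n * bar F p e N.1 = antidiag F n := hN
  have h1 : N.1.transpose * (antidiag F n * bar F p e N.1 * antidiag F n) = 1 := by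
    rw [← antidiag_mul_antidiag, ← mul_assoc, ← mul_assoc, hN]
  have h2 : bar F p e N.1 * antidiag F n * N.1.transpose = antidiag F n := by
    rw [mul_eq_one_comm] at h1
    calc _ = antidiag F n * antidiag F n * (bar F p e N.1 * antidiag F n * N.1.transpose) := by
          rw [antidiag_mul_antidiag, one_mul]
      _ = antidiag F n * (antidiag F n * bar F p e N.1 * antidiag F n * N.1.transpose) := by
          simp only [mul_assoc]
      _ = _ := by rw [h1, mul_one]
  have h3 := congrFun (congrFun h2 j) i
  have h4 : antidiag F n j i = antidiag F n i j := by
    simp only [antidiag, Matrix.of_apply, eq_rev_comm (i := i)]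
  rw [← h4, ← h3]
  rw [Matrix.mul_apply]
  refine Finset.sum_congr rfl fun l _ => ?_
  rw [mul_antidiag_apply, bar, Matrix.map_apply, Matrix.transpose_apply, mul_comm]

theorem exists_mem_sylow {m : ℕ} {N : Matrix (Fin (2 * m)) (Fin (2 * m)) F}
    (h1 : ∀ i, N i i = 1) (h0 : ∀ i j, i < j → N i j = 0)
    (hN : N.transpose * antidiag F (2 * m) * bar F p e N = antidiag F (2 * m)) :
    ∃ g ∈ sylow F p e m, g.1 = N := by
  have hdet : N.det ≠ 0 := by
    rw [Matrix.det_of_isLowerTriangular N (fun i j h => h0 i j h)]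
    simp [h1]
  exact ⟨Matrix.GeneralLinearGroup.mkOfDetNeZero N hdet, ⟨⟨h1, h0⟩, hN⟩, rfl⟩

variable (F p e) in
/-- The vectors `b` such that `x_j + ∑ b_l x_l` lies in the orbit of `x_j`, for `j` in the first
half of the indices or right after it (indices start from `0`, so that `j ≤ m`): only indices below
`j` occur, and the coefficient at the index dual to `j` has trace `0`. The second condition is
relevant only for `j = m`. -/
def orbitVectors (m : ℕ) (j : Fin (2 * m)) : AddSubgroup (Fin (2 * m) → F) where
  carrier := {b | (∀ l, j ≤ l → b l = 0) ∧ b j.rev + b j.rev ^ p ^ e = 0}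
  zero_mem' := by simp [(Fact.out : p.Prime).ne_zero]
  add_mem' := by
    rintro a b ⟨ha, ha'⟩ ⟨hb, hb'⟩
    refine ⟨fun l hl => by simp [ha l hl, hb l hl], ?_⟩
    rw [Pi.add_apply, add_pow_char_pow]
    linear_combination ha' + hb'
  neg_mem' := by
    rintro a ⟨ha, ha'⟩
    refine ⟨fun l hl => by simp [ha l hl], ?_⟩
    have : (0 - a j.rev) ^ p ^ e = 0 ^ p ^ e - a j.rev ^ p ^ e := sub_pow_char_pow ..
    rw [zero_sub, zero_pow (pow_ne_zero _ (Fact.out : p.Prime).ne_zero)] at this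
    rw [Pi.neg_apply, this]
    linear_combination -ha'

/-- The trace condition is the isotropy of the row at `j`: as `j ≤ m`, only the indices `j` and
`j.rev` contribute to the value of the form on that row. -/
theorem row_mem_orbitVectors {m : ℕ} {N : GL (Fin (2 * m)) F} (hN : N ∈ sylow F p e m)
    {j : Fin (2 * m)} (hj : (j : ℕ) ≤ m) :
    N.1 j - Pi.single j 1 ∈ orbitVectors F p e m j := by
  obtain ⟨⟨h1, h0⟩, hu⟩ := hN
  refine ⟨fun l hl => ?_, ?_⟩
  · rcases hl.eq_or_lt with rfl | hl
    · simp [h1]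
    · simp [h0 j l hl, hl.ne']
  · have hrow := row_relation hu j j
    rw [Finset.sum_eq_add j j.rev (rev_ne_self j).symm ?_ (by simp) (by simp)] at hrow
    · simp only [antidiag, Matrix.of_apply, h1, Fin.rev_rev, one_pow, mul_one, one_mul,
        if_neg (rev_ne_self j).symm] at hrow
      simpa [rev_ne_self j, add_comm] using hrow
    · rintro l - ⟨hl1, hl2⟩
      rcases lt_or_gt_of_ne hl1 with hl | hl
      · rw [h0 j l.rev, zero_pow (pow_ne_zero _ (Fact.out : p.Prime).ne_zero), mul_zero]
        rw [Fin.lt_def] at hl ⊢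
        have : (l.rev : ℕ) ≠ j := fun h => hl2 (by rw [← Fin.ext h, Fin.rev_rev])
        rw [Fin.val_rev] at this ⊢
        omega
      · rw [h0 j l hl, zero_mul]

/-- Every vector of `orbitVectors` occurs: the identity is changed in the row `j` and the dual column
only. -/
theorem exists_mem_sylow_row_eq [Finite F] (hF : Nat.card F = (p ^ e) ^ 2) {m : ℕ}
    {j : Fin (2 * m)} (hj : (j : ℕ) ≤ m) {b : Fin (2 * m) → F} (hb : b ∈ orbitVectors F p e m j) :
    ∃ N ∈ sylow F p e m, N.1 j = Pi.single j 1 + b := by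
  obtain ⟨hb0, hbj⟩ := hb
  have hq : p ^ e ≠ 0 := pow_ne_zero _ (Fact.out : p.Prime).ne_zero
  -- The row `b` at `j` is compensated by the column `-c` at the index dual to `j`.
  let b' : Fin (2 * m) → F := Function.update b j.rev 0
  have hb'j : b' j.rev = 0 := by simp [b']
  have hb'0 : ∀ l, j ≤ l → b' l = 0 := fun l hl => by
    by_cases h : l = j.rev
    · rw [h, hb'j]
    · simp [b', h, hb0 l hl]
  let c : Fin (2 * m) → F := fun i => b' i.rev ^ p ^ e
  have hc (i) : c i.rev ^ p ^ e = b' i := by simp only [c, Fin.rev_rev, bar_bar hF]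
  have hc0 (i) : c i * b' i = 0 := by
    by_cases h : j ≤ i
    · rw [hb'0 i h, mul_zero]
    by_cases h' : i = j.rev
    · rw [h', hb'j, mul_zero]
    simp only [c]
    rw [hb'0 i.rev, zero_pow hq, zero_mul]
    rw [Fin.le_def, Fin.val_rev]
    rw [Fin.le_def] at h
    omega
  let N : Matrix (Fin (2 * m)) (Fin (2 * m)) F := fun i l =>
    (if i = l then 1 else 0) + (if i = j then b l else 0) - (if l = j.rev then c i else 0)
  have hN1 (i) : N i i = 1 := by
    have e1 : (if i = j then b i else 0) = 0 := by
      split_ifs with h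
      · rw [h, hb0 j le_rfl]
      · rfl
    have e2 : (if i = j.rev then c i else 0) = 0 := by
      split_ifs with h
      · simp only [h, c, Fin.rev_rev, hb'0 j le_rfl, zero_pow hq]
      · rfl
    simp [N, e1, e2]
  have hN0 (i l) (hil : i < l) : N i l = 0 := by
    have e1 : (if i = j then b l else 0) = 0 := by
      split_ifs with h
      · rw [hb0 l (h ▸ hil.le)]
      · rfl
    have e2 : (if l = j.rev then c i else 0) = 0 := by
      split_ifs with h
      · simp only [c]
        rw [hb'0 i.rev, zero_pow hq]
        rw [h] at hil
        exact (Fin.lt_rev_iff.mp hil).le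
      · rfl
    simp [N, e1, e2, hil.ne]
  have hbar (i r) : N i.rev r ^ p ^ e =
      (if i.rev = r then 1 else 0) + (if i.rev = j then b r ^ p ^ e else 0) -
        (if r = j.rev then b' i else 0) := by
    simp only [N]
    rw [sub_pow_char_pow, add_pow_char_pow]
    simp only [ite_pow, one_pow, zero_pow hq, hc]
  obtain ⟨g, hg, hgN⟩ := exists_mem_sylow (p := p) (e := e) hN1 hN0 (by
    ext l r
    have hbb : (if l = j.rev then b r ^ p ^ e else 0) - (if r = j.rev then b' l else 0) +
      (if r = j.rev then b l else 0) - (if l = j.rev then b' r ^ p ^ e else 0) = 0 := by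
      by_cases hl : l = j.rev <;> by_cases hr : r = j.rev
      · subst hl hr
        simp [hb'j, zero_pow hq, add_comm, hbj]
      · simp [hl, hr, b']
      · simp [hl, hr, b']
      · simp [hl, hr]
    -- All terms of the form cancel except that of the identity matrix.
    have hsum : ∑ i, c i * b' i = 0 := Finset.sum_eq_zero fun i _ => hc0 i
    rw [form_apply]
    simp only [hbar, N]
    simp [mul_add, add_mul, mul_sub, sub_mul, Finset.sum_add_distrib, Finset.sum_sub_distrib]
    have hcr : c r.rev = b' r ^ p ^ e := by simp only [c, Fin.rev_rev]
    have hcj : c j.rev = 0 := by simp only [c, Fin.rev_rev, hb'0 j le_rfl, zero_pow hq]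
    simp only [Fin.rev_eq_iff, Finset.sum_ite_eq', Finset.mem_univ, if_true, hsum, hb'0 j le_rfl,
      hcr, hcj, if_neg (rev_ne_self j).symm, sub_zero, antidiag, Matrix.of_apply, mul_zero, zero_mul, ite_self,
      eq_comm (a := j.rev), eq_comm (a := r.rev), eq_rev_comm (i := l) (j := r),
      eq_rev_comm (i := j) (j := r)]
    split_ifs at hbb ⊢ <;> linear_combination hbb)
  refine ⟨g, hg, funext fun l => ?_⟩
  have hcj : c j = 0 := by simp only [c, hb'j, zero_pow hq]
  rw [hgN]
  simp [N, hcj, Pi.single_apply, eq_comm]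

end Matrices

/-! ### Orbit products and the conjugates of the coordinates in the first half -/

section AdditiveProduct

open Polynomial

variable {A L : Type*} [AddCommGroup A] [Fintype A] [Field L] {f : A →+ L}

/-- The polynomial `∏ (T + w)` over a finite group of translations `w` is constant on its cosets,
hence differs from `∏ (T - c - w)` by a constant. -/
theorem prod_X_add_sub_eq (hf : Function.Injective f) (c : L) :
    ∏ a, (X + C (f a)) - C (∏ a, (c + f a)) = ∏ a, (X - C (c + f a)) := by
  classical
  have hinj : Function.Injective fun a => c + f a := fun a b h => hf (add_left_cancel h)
  have hpos : 0 < Fintype.card A := Fintype.card_pos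
  have hd1 : (∏ a, (X + C (f a))).degree = (Fintype.card A : WithBot ℕ) := by
    simp [degree_prod]
  have hd2 : (∏ a, (X - C (c + f a))).degree = (Fintype.card A : WithBot ℕ) := by
    simp only [degree_prod, degree_X_sub_C]; simp
  have hm1 : (∏ a, (X + C (f a))).Monic := monic_prod_of_monic _ _ fun a _ => monic_X_add_C _
  have hm2 : (∏ a, (X - C (c + f a))).Monic := monic_prod_of_monic _ _ fun a _ => monic_X_sub_C _
  have hlt : (C (∏ a, (c + f a))).degree < (∏ a, (X + C (f a))).degree := by
    rw [hd1]
    exact degree_C_le.trans_lt (by exact_mod_cast hpos)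
  have hd3 := degree_sub_eq_left_of_degree_lt hlt
  have hm3 := hm1.sub_of_left hlt
  refine Polynomial.eq_of_degree_sub_lt_of_eval_finset_eq (Finset.univ.image fun a => c + f a) ?_ ?_
  · rw [Finset.card_image_of_injective _ hinj, Finset.card_univ]
    refine (degree_sub_lt_left (by rw [hd3, hd1, hd2]) hm3.ne_zero (by rw [hm3, hm2])).trans_le ?_
    rw [hd3, hd1]
  · intro z hz
    obtain ⟨b, -, rfl⟩ := Finset.mem_image.mp hz
    have h2 : (∏ a, (X - C (c + f a))).eval (c + f b) = 0 := by
      rw [eval_prod]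
      exact Finset.prod_eq_zero (Finset.mem_univ b) (by simp)
    rw [h2, eval_sub, eval_prod, eval_C, sub_eq_zero]
    simp only [eval_add, eval_X, eval_C]
    refine Fintype.prod_equiv (Equiv.addLeft b) _ _ fun a => ?_
    simp [add_assoc]

/-- The polynomial `∏ (T + w)` separates the cosets of the group of translations. -/
theorem exists_eq_add_of_prod_add_eq (hf : Function.Injective f) {c d : L}
    (h : ∏ a, (d + f a) = ∏ a, (c + f a)) : ∃ a, d = c + f a := by
  have := congrArg (eval d) (prod_X_add_sub_eq hf c)
  rw [eval_sub, eval_prod, eval_prod, eval_C] at this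
  simp only [eval_add, eval_X, eval_C, eval_sub, h, sub_self] at this
  obtain ⟨a, -, ha⟩ := Finset.prod_eq_zero_iff.mp this.symm
  exact ⟨a, sub_eq_zero.mp ha⟩

theorem eval_derivative_prod_X_add_ne_zero (hf : Function.Injective f) (c : L) :
    (derivative (∏ a, (X + C (f a)))).eval c ≠ 0 := by
  have hinj : Function.Injective fun a => c + f a := fun a b h => hf (add_left_cancel h)
  have h1 := congrArg derivative (prod_X_add_sub_eq hf c)
  rw [derivative_sub, derivative_C, sub_zero] at h1
  rw [h1]
  have hsep : (∏ a, (X - C (c + f a))).Separable := separable_prod_X_sub_C_iff.mpr hinj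
  refine hsep.eval₂_derivative_ne_zero (RingHom.id L) ?_
  rw [← eval, eval_prod]
  exact Finset.prod_eq_zero (Finset.mem_univ 0) (by simp)

theorem derivation_prod_add {R M ι : Type*} [CommRing R] [Algebra R L] [AddCommGroup M] [Module L M]
    [Module R M] (D : Derivation R L M) (s : Finset ι) (w : ι → L) (hw : ∀ i, D (w i) = 0) (c : L) :
    D (∏ i ∈ s, (c + w i)) = (derivative (∏ i ∈ s, (X + C (w i)))).eval c • D c := by
  classical
  induction s using Finset.induction_on with
  | empty => simp
  | insert i s hi ih =>
    rw [Finset.prod_insert hi, Finset.prod_insert hi, D.leibniz, ih, map_add, hw, derivative_mul]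
    simp [eval_prod, add_smul, mul_smul, add_comm]

end AdditiveProduct

section Conjugates

open MvPolynomial

variable {F L : Type*} [Field F] [Field L] [Algebra F L] {p e : ℕ} {m : ℕ}

theorem h_eq_sum_univ (q m k : ℕ) :
    h F q m k = ∑ i : Fin (2 * m), X i.rev * X i ^ q ^ (2 * k - 1) := by
  rw [← Equiv.sum_comp (finCongr (two_mul m).symm), Fin.sum_univ_add,
    ← Equiv.sum_comp Fin.revPerm (fun i : Fin m => _ * X (finCongr _ (Fin.natAdd m i)) ^ _),
    ← Finset.sum_add_distrib]
  refine Finset.sum_congr rfl fun i _ => ?_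
  have h1 : finCongr (two_mul m).symm (Fin.castAdd m i) = Fin.castLE (by omega) i := rfl
  have h2 : finCongr (two_mul m).symm (Fin.natAdd m (Fin.revPerm i)) =
      (Fin.castLE (by omega) i : Fin (2 * m)).rev := by
    ext
    simp
    omega
  rw [h1, h2, Fin.rev_rev]
  ring

theorem eq_zero_of_sum_mul_pow_eq_zero_of_algebraicIndependent {n : ℕ} {x : Fin n → L}
    (hx : AlgebraicIndependent F x) {q : ℕ} (hq : 2 ≤ q) {B : Fin n → Fin n → F}
    (hB : ∑ i, ∑ j, B i j • (x i * x j ^ q) = 0) (i j : Fin n) : B i j = 0 := by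
  -- The monomials `x_i x_j ^ q` are pairwise distinct because `q ≥ 2`.
  let s : Fin n × Fin n → (Fin n →₀ ℕ) := fun t => Finsupp.single t.1 1 + Finsupp.single t.2 q
  have hs : Function.Injective s := by
    rintro ⟨i, j⟩ ⟨i', j'⟩ h
    have hj : j = j' := by
      by_contra hne
      have := DFunLike.congr_fun h j
      simp only [s, Finsupp.add_apply, Finsupp.single_apply, if_neg (Ne.symm hne), if_true] at this
      split_ifs at this <;> omega
    subst hj
    have hi : Finsupp.single i 1 = Finsupp.single i' 1 := add_right_cancel h
    rw [Finsupp.single_left_injective one_ne_zero hi]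
  have hli := (basisMonomials (Fin n) F).linearIndependent.comp s hs
  rw [Fintype.linearIndependent_iff] at hli
  refine hli (fun t => B t.1 t.2) (hx ?_) (i, j)
  rw [map_zero, map_sum, ← hB, Fintype.sum_prod_type]
  refine Finset.sum_congr rfl fun i _ => Finset.sum_congr rfl fun j _ => ?_
  simp only [s, Function.comp_apply, coe_basisMonomials, map_smul, monomial_add_single, map_mul,
    map_pow, aeval_X]
  rw [← X]
  simp

variable [Fact p.Prime] [CharP F p]

theorem injective_linearCombination_orbitVectors {x : Fin (2 * m) → L} (hx : LinearIndependent F x)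
    (j : Fin (2 * m)) : Function.Injective ((Fintype.linearCombination F x).toAddMonoidHom.comp
      (orbitVectors F p e m j).subtype) :=
  (linearIndependent_iff_injective_fintypeLinearCombination.mp hx).comp Subtype.val_injective

/-- The step from `i < j` to `j` in the determination of the conjugates of the coordinates: if each
earlier conjugate differs from its coordinate by an admissible translation, the groups of
translations for `j` formed from `x` and from `y` coincide, and the equality of orbit products
identifies `y j` up to such a translation. -/
theorem exists_add_of_prod_orbitVectors_eq [Finite F] {x y : Fin (2 * m) → L}
    (hx : LinearIndependent F x)
    (hy : LinearIndependent F y) (j : Fin (2 * m)) (hjm : (j : ℕ) ≤ m)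
    (hlt : ∀ i < j, ∃ b ∈ orbitVectors F p e m i, y i = x i + ∑ l, b l • x l)
    (h : ∏ᶠ b : orbitVectors F p e m j, (y j + ∑ l, b.1 l • y l) =
      ∏ᶠ b : orbitVectors F p e m j, (x j + ∑ l, b.1 l • x l)) :
    ∃ b ∈ orbitVectors F p e m j, y j = x j + ∑ l, b l • x l := by
  have := Fintype.ofFinite (orbitVectors F p e m j)
  let f (x : Fin (2 * m) → L) := (Fintype.linearCombination F x).toAddMonoidHom.comp
      (orbitVectors F p e m j).subtype
  have hf (x : Fin (2 * m) → L) (b) : f x b = ∑ l, b.1 l • x l := rfl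
  choose! c hc hyc using hlt
  -- The translations for `y` form the same group as those for `x`.
  have key : ∀ b : orbitVectors F p e m j, ∃ b' : orbitVectors F p e m j, f x b' = f y b := by
    rintro ⟨b, hb0, hbj⟩
    refine ⟨⟨b + ∑ i, b i • c i, ⟨fun l hl => ?_, ?_⟩⟩, ?_⟩
    · rw [Pi.add_apply, hb0 l hl, zero_add, Finset.sum_apply]
      refine Finset.sum_eq_zero fun i _ => ?_
      rcases lt_or_ge i j with hi | hi
      · rw [Pi.smul_apply, (hc i hi).1 l (hi.le.trans hl), smul_zero]
      · rw [hb0 i hi, zero_smul, Pi.zero_apply]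
    · suffices h0 : (∑ i, b i • c i) j.rev = 0 by rw [Pi.add_apply, h0, add_zero, hbj]
      rw [Finset.sum_apply]
      refine Finset.sum_eq_zero fun i _ => ?_
      rcases lt_or_ge i j with hi | hi
      · rw [Pi.smul_apply, (hc i hi).1 j.rev, smul_zero]
        rw [Fin.lt_def] at hi
        rw [Fin.le_def, Fin.val_rev]
        omega
      · rw [hb0 i hi, zero_smul, Pi.zero_apply]
    · simp only [hf, Pi.add_apply, add_smul, Finset.sum_add_distrib, Finset.sum_apply,
        Pi.smul_apply, Finset.sum_smul]
      rw [Finset.sum_comm, ← Finset.sum_add_distrib]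
      refine Finset.sum_congr rfl fun i _ => ?_
      rcases lt_or_ge i j with hi | hi
      · rw [hyc i hi, smul_add, Finset.smul_sum]
        simp [mul_smul]
      · simp [hb0 i hi]
  choose T hT using key
  have hTinj : Function.Injective T := fun a b hab =>
    injective_linearCombination_orbitVectors hy j (by
      change f y a = f y b
      rw [← hT, ← hT, hab])
  have hTbij : Function.Bijective T := Finite.injective_iff_bijective.mp hTinj
  rw [finprod_eq_prod_of_fintype, finprod_eq_prod_of_fintype] at h
  have h2 : ∏ b, (y j + f x b) = ∏ b, (x j + f x b) := by
    rw [← hTbij.prod_comp]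
    simpa only [hT, hf] using h
  obtain ⟨b, hb⟩ := exists_eq_add_of_prod_add_eq
    (injective_linearCombination_orbitVectors hx j) h2
  exact ⟨b.1, b.2, hb⟩

end Conjugates

/-! ### The conjugates of all coordinates -/

section AllConjugates

open MvPolynomial

variable {F L : Type*} [Field F] [Field L] [Algebra F L] {p e : ℕ} {m : ℕ}
  [Fact p.Prime]

theorem aeval_h (x : Fin (2 * m) → L) (q k : ℕ) :
    aeval x (h F q m k) = ∑ i : Fin m,
      (x (Fin.castLE (by omega) i).rev ^ q ^ (2 * k - 1) * x (Fin.castLE (by omega) i) +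
        x (Fin.castLE (by omega) i).rev * x (Fin.castLE (by omega) i) ^ q ^ (2 * k - 1)) := by
  simp [h]

/-- The matrix of the form `∑ y_{rev i} y_i ^ Q`, `Q` an odd power of `q`, after the substitution
`y = N x`. -/
theorem sum_rev_mul_pow [Finite F] (hF : Nat.card F = (p ^ e) ^ 2) {R : Type*} [CommRing R]
    [Algebra F R] [CharP R p] {n : ℕ} {x y : Fin n → R} {N : Matrix (Fin n) (Fin n) F}
    (hy : ∀ i, y i = ∑ l, N i l • x l) {k : ℕ} (hk : 1 ≤ k) :
    ∑ i, y i.rev * y i ^ (p ^ e) ^ (2 * k - 1) =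
      ∑ l, ∑ r, (N.transpose * antidiag F n * bar F p e N) l r •
        (x l * x r ^ (p ^ e) ^ (2 * k - 1)) := by
  rw [← Equiv.sum_comp Fin.revPerm]
  have hsum (i : Fin n) : (∑ l, N i l • x l) ^ (p ^ e) ^ (2 * k - 1) =
      ∑ l, N i l ^ p ^ e • x l ^ (p ^ e) ^ (2 * k - 1) := by
    rw [← pow_mul p, sum_pow_char_pow]
    simp only [pow_mul p, _root_.smul_pow, pow_odd_frobenius hF _ hk]
  simp only [Fin.revPerm_apply, Fin.rev_rev, hy, hsum, form_apply,
    Finset.sum_mul_sum, Finset.sum_smul, smul_mul_smul_comm]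
  rw [Finset.sum_comm]
  exact Finset.sum_congr rfl fun l _ => Finset.sum_comm

variable [CharP F p]

theorem form_eq_of_sum_eq [Finite F] (hF : Nat.card F = (p ^ e) ^ 2) (he : 2 ≤ p ^ e) {n : ℕ}
    {x y : Fin n → L} (hx : AlgebraicIndependent F x) {N : Matrix (Fin n) (Fin n) F}
    (hy : ∀ i, y i = ∑ l, N i l • x l)
    (h : ∑ i, y i.rev * y i ^ (p ^ e) ^ (2 * 1 - 1) = ∑ i, x i.rev * x i ^ (p ^ e) ^ (2 * 1 - 1)) :
    N.transpose * antidiag F n * bar F p e N = antidiag F n := by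
  have := charP_of_injective_algebraMap (algebraMap F L).injective p
  ext l r
  rw [← sub_eq_zero]
  refine eq_zero_of_sum_mul_pow_eq_zero_of_algebraicIndependent hx he
    (B := fun l r => (N.transpose * antidiag F n * bar F p e N) l r - antidiag F n l r) ?_ l r
  rw [sum_rev_mul_pow hF hy le_rfl,
    sum_rev_mul_pow hF (N := 1) (x := x) (fun i => by simp [Matrix.one_apply]) le_rfl] at h
  simpa [sub_smul, bar_eq, sub_eq_zero] using h

/-- A unitary matrix whose first `m + 1` rows are lower unitriangular is lower unitriangular. -/
theorem lowerUnitriangular_of_rows {N : Matrix (Fin (2 * m)) (Fin (2 * m)) F}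
    (hN : N.transpose * antidiag F (2 * m) * bar F p e N = antidiag F (2 * m))
    (h1 : ∀ i : Fin (2 * m), (i : ℕ) ≤ m → N i i = 1)
    (h0 : ∀ i j : Fin (2 * m), (i : ℕ) ≤ m → i < j → N i j = 0) (i j : Fin (2 * m)) (hij : i ≤ j) :
    N i j = if i = j then 1 else 0 := by
  have hq : p ^ e ≠ 0 := pow_ne_zero _ (Fact.out : p.Prime).ne_zero
  induction i using WellFoundedLT.induction generalizing j with
  | ind i ih =>
    by_cases hi : (i : ℕ) ≤ m
    · rcases hij.eq_or_lt with rfl | hij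
      · rw [h1 i hi, if_pos rfl]
      · rw [h0 i j hi hij, if_neg hij.ne]
    have hrev : (i.rev : ℕ) ≤ m := by rw [Fin.val_rev]; omega
    -- The entry of the hermitian form at `(i.rev, j)` reduces to the single term `N i j`.
    have key := congrFun (congrFun hN i.rev) j
    rw [form_apply, Finset.sum_eq_single i.rev, h1 _ hrev, one_mul, Fin.rev_rev] at key
    · have hinj : Function.Injective fun a : F => a ^ p ^ e := iterateFrobenius_inj F p e
      apply hinj
      simp only [key, antidiag, Matrix.of_apply, Fin.rev_rev, eq_comm (a := j), ite_pow, one_pow,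
        zero_pow hq]
    · intro t _ ht
      rcases lt_or_gt_of_ne ht with h | h
      · rw [h0 t i.rev (by rw [Fin.lt_def] at h; omega) h, zero_mul]
      · have : t.rev < i := by rwa [← Fin.rev_lt_rev, Fin.rev_rev]
        rw [ih t.rev this j (this.le.trans hij), if_neg (this.trans_le hij).ne, zero_pow hq,
          mul_zero]
    · simp

theorem sum_castLE {M : Type*} [AddCommMonoid M] (g : Fin (2 * m) → M)
    (hg : ∀ l : Fin (2 * m), m ≤ l → g l = 0) :
    ∑ l, g l = ∑ l : Fin m, g (Fin.castLE (by omega) l) := by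
  symm
  refine Fintype.sum_of_injective _ (Fin.castLE_injective (by omega)) _ _ (fun l hl => ?_)
    fun _ => rfl
  refine hg l (not_lt.mp fun h => hl ⟨⟨l, h⟩, rfl⟩)

/-- A conjugate `y` of the coordinates `x` with the same values of the orbit products and of the
`h_k` is the image of `x` under a matrix of the Sylow group. -/
theorem exists_mem_sylow_of_generators_eq [Finite F] (hF : Nat.card F = (p ^ e) ^ 2) (hm : 1 ≤ m)
    {x y : Fin (2 * m) → L} (hx : AlgebraicIndependent F x) (hy : LinearIndependent F y)
    (hN : ∀ j : Fin (2 * m), (j : ℕ) ≤ m →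
      ∏ᶠ b : orbitVectors F p e m j, (y j + ∑ l, b.1 l • y l) =
      ∏ᶠ b : orbitVectors F p e m j, (x j + ∑ l, b.1 l • x l))
    (hh : ∀ k, 1 ≤ k → k ≤ m - 1 →
      aeval y (h F (p ^ e) m k) = aeval x (h F (p ^ e) m k)) :
    ∃ N ∈ sylow F p e m, ∀ i, y i = ∑ l, N.1 i l • x l := by
  have := charP_of_injective_algebraMap (algebraMap F L).injective p
  have hxl : LinearIndependent F x := hx.linearIndependent
  have hq : 2 ≤ p ^ e := by
    have h1 : 1 < Nat.card F := Finite.one_lt_card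
    rw [hF] at h1
    by_contra hlt
    have : p ^ e ≤ 1 := by omega
    have : (p ^ e) ^ 2 ≤ 1 ^ 2 := Nat.pow_le_pow_left this 2
    omega
  have hb : ∀ j : Fin (2 * m), (j : ℕ) ≤ m →
      ∃ b ∈ orbitVectors F p e m j, y j = x j + ∑ l, b l • x l := by
    intro j
    induction j using WellFoundedLT.induction with
    | ind j ih =>
      intro hj
      exact exists_add_of_prod_orbitVectors_eq hxl hy j hj
        (fun i hi => ih i hi (by rw [Fin.lt_def] at hi; omega)) (hN j hj)
  choose! b hb hyb using hb
  have hrow (j : Fin (2 * m)) (hj : (j : ℕ) ≤ m) :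
      y j = ∑ l, (Pi.single j 1 + b j : Fin (2 * m) → F) l • x l := by
    rw [hyb j hj]
    simp [add_smul, Finset.sum_add_distrib, Pi.single_apply, ite_smul]
  rcases hm.eq_or_lt with rfl | hm2
  · -- No `h_k` occurs for `m = 1`, but then the orbit products determine both rows.
    obtain ⟨N, hNs, hN1⟩ := exists_mem_sylow_row_eq hF (j := 1) le_rfl (hb 1 le_rfl)
    refine ⟨N, hNs, fun i => ?_⟩
    fin_cases i
    · have h00 := hNs.1.1 0
      have h01 := hNs.1.2 0 1 (by decide)
      have hb0 := (hb 0 (by simp)).1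
      simp only [Fin.zero_eta]
      rw [hyb 0 (by simp)]
      simp only [hb0 _ (Fin.zero_le _), zero_smul, Finset.sum_const_zero, add_zero]
      have : ∑ l, N.1 0 l • x l = N.1 0 0 • x 0 + N.1 0 1 • x 1 := Fin.sum_univ_two _
      rw [this, h00, h01, one_smul, zero_smul, add_zero]
    · change y 1 = ∑ l, N.1 1 l • x l
      rw [hN1]
      exact hrow 1 le_rfl
  obtain ⟨n, rfl⟩ : ∃ n, m = n + 1 := ⟨m - 1, by omega⟩
  let ι : Fin (n + 1) → Fin (2 * (n + 1)) := Fin.castLE (by omega)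
  have hι (i) : (ι i : ℕ) = i := rfl
  have hlast : ((ι (Fin.last n)).rev : ℕ) = n + 1 := by rw [Fin.val_rev, hι, Fin.val_last]; omega
  -- The conjugates of the coordinates in the second half are linear combinations of coordinates.
  have hspan (i : Fin (n + 1)) : y (ι i).rev ∈ Submodule.span F (Set.range x) := by
    refine Submodule.span_mono ?_ (mem_span_of_forms_eq hF (u := fun i => x (ι i))
      (u' := fun i => x (ι i).rev) (v := fun i => y (ι i)) (v' := fun i => y (ι i).rev)
      (a := fun i j => (Pi.single (ι i) 1 + b (ι i) : Fin (2 * (n + 1)) → F) (ι j))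
      (b := fun j => b (ι (Fin.last n)).rev (ι j))
      (hxl.comp _ (Fin.castLE_injective _)) (fun i => ?_) (fun i j hij => ?_) (fun i => ?_) ?_ ?_
      (fun k h1 h2 => ?_) i)
    · rintro _ (⟨i, rfl⟩ | ⟨i, rfl⟩) <;> exact ⟨_, rfl⟩
    · simp [(hb (ι i) (by rw [hι]; omega)).1 _ le_rfl]
    · have hij : ι i < ι j := hij
      simp [(hb (ι i) (by rw [hι]; omega)).1 _ hij.le, hij.ne']
    · rw [hrow _ (by rw [hι]; omega)]
      refine sum_castLE _ fun l hl => ?_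
      have hil : ι i < l := by rw [Fin.lt_def, hι]; omega
      simp [(hb (ι i) (by rw [hι]; omega)).1 _ hil.le, hil.ne']
    · simpa using (hb (ι (Fin.last n)).rev hlast.le).2
    · rw [hyb _ hlast.le]
      congr 1
      refine sum_castLE _ fun l hl => ?_
      rw [(hb _ hlast.le).1 l (by rw [Fin.le_def, hlast]; exact hl), zero_smul]
    · have := hh k h1 (by omega)
      rwa [aeval_h, aeval_h] at this
  have hex (i : Fin (2 * (n + 1))) : ∃ c : Fin (2 * (n + 1)) → F,
      y i = ∑ l, c l • x l ∧ ((i : ℕ) ≤ n + 1 → c = Pi.single i 1 + b i) := by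
    by_cases hi : (i : ℕ) ≤ n + 1
    · exact ⟨_, hrow i hi, fun _ => rfl⟩
    · have : i = (ι ⟨i.rev, by rw [Fin.val_rev]; omega⟩).rev := by
        rw [eq_rev_comm]; ext; rfl
      obtain ⟨c, hc⟩ := (Submodule.mem_span_range_iff_exists_fun F).mp (this ▸ hspan _)
      exact ⟨c, hc.symm, fun h => absurd h hi⟩
  choose N hNy hNrow using hex
  have hform : (Matrix.of N).transpose * antidiag F _ * bar F p e (Matrix.of N) = antidiag F _ := by
    refine form_eq_of_sum_eq hF hq hx hNy ?_
    have := hh 1 le_rfl (by omega)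
    rw [h_eq_sum_univ] at this
    simpa only [map_sum, map_mul, map_pow, aeval_X] using this
  have htri := lowerUnitriangular_of_rows hform
    (fun i hi => by simp [hNrow i hi, (hb i hi).1 i le_rfl])
    (fun i j hi hij => by simp [hNrow i hi, (hb i hi).1 j hij.le, hij.ne'])
  obtain ⟨g, hg, hgN⟩ := exists_mem_sylow (fun i => by simpa using htri i i le_rfl)
    (fun i j hij => by simpa [hij.ne] using htri i j hij.le) hform
  exact ⟨g, hg, fun i => by rw [hgN]; exact hNy i⟩

end AllConjugates

/-! ### Invariance of the generators -/

section Invariance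

open MvPolynomial

variable {F : Type*} [Field F] {p e : ℕ} {m : ℕ}

theorem polyAction_X {n : ℕ} (g : GL (Fin n) F) (i : Fin n) :
    polyAction F n g (X i) = ∑ l, (g⁻¹).1 i l • X l := by
  simp [polyAction, polySubst, smul_eq_C_mul]

theorem fieldAction_algebraMap {n : ℕ} (g : GL (Fin n) F) (f : MvPolynomial (Fin n) F) :
    fieldAction F n g (algebraMap _ (RatFunc F n) f) = algebraMap _ _ (polyAction F n g f) :=
  IsFractionRing.fieldEquivOfAlgEquiv_algebraMap ..

theorem mem_invariantField_iff {n : ℕ} {G : Subgroup (GL (Fin n) F)} {z : RatFunc F n} :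
    z ∈ invariantField G ↔ ∀ g ∈ G, fieldAction F n g z = z := by
  rw [invariantField, IntermediateField.mem_fixedField_iff]
  simp

theorem polyAction_orbitProduct [Finite F] {n : ℕ} {G : Subgroup (GL (Fin n) F)}
    {g : GL (Fin n) F} (hg : g ∈ G) (f : MvPolynomial (Fin n) F) :
    polyAction F n g (orbitProduct G f) = orbitProduct G f := by
  have hfin : {y | ∃ g ∈ G, polyAction F n g f = y}.Finite :=
    (Set.toFinite (G : Set (GL (Fin n) F))).image fun g => polyAction F n g f
  rw [orbitProduct, show polyAction F n g _ = (polyAction F n g).toMulEquiv _ from rfl,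
    MulEquiv.map_finprod_mem _ _ hfin]
  refine finprod_mem_eq_of_bijOn (polyAction F n g) ⟨?_, (polyAction F n g).injective.injOn, ?_⟩
    fun _ _ => rfl
  · rintro _ ⟨a, ha, rfl⟩
    exact ⟨g * a, G.mul_mem hg ha, by rw [map_mul]; rfl⟩
  · rintro _ ⟨a, ha, rfl⟩
    refine ⟨_, ⟨g⁻¹ * a, G.mul_mem (G.inv_mem hg) ha, rfl⟩, ?_⟩
    rw [← AlgEquiv.mul_apply, ← map_mul, mul_inv_cancel_left]

variable [Fact p.Prime] [CharP F p]

theorem polyAction_h [Finite F] (hF : Nat.card F = (p ^ e) ^ 2) {g : GL (Fin (2 * m)) F}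
    (hg : g ∈ sylow F p e m) {k : ℕ} (hk : 1 ≤ k) :
    polyAction F (2 * m) g (h F (p ^ e) m k) = h F (p ^ e) m k := by
  have hN : (g⁻¹).1.transpose * antidiag F (2 * m) * bar F p e (g⁻¹).1 = antidiag F (2 * m) :=
    ((sylow F p e m).inv_mem hg).2
  rw [h_eq_sum_univ]
  simp only [map_sum, map_mul, map_pow]
  rw [sum_rev_mul_pow hF (polyAction_X g) hk, hN,
    sum_rev_mul_pow hF (N := 1) (x := X) (fun i => by simp [Matrix.one_apply]) hk]
  simp [bar_eq]

theorem polyAction_X_zero (hm : 0 < 2 * m) {g : GL (Fin (2 * m)) F} (hg : g ∈ sylow F p e m) :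
    polyAction F (2 * m) g (X ⟨0, hm⟩) = X ⟨0, hm⟩ := by
  have h1 := ((sylow F p e m).inv_mem hg).1
  rw [polyAction_X, Finset.sum_eq_single ⟨0, hm⟩, h1.1, one_smul]
  · intro l _ hl
    rw [h1.2 _ l (lt_of_le_of_ne (Nat.zero_le _) (Ne.symm hl)), zero_smul]
  · simp

/-- The orbit of a coordinate in the first half, or of the one after it, is the set of its
translates by the linear forms from `orbitVectors`. -/
theorem orbitProduct_X [Finite F] (hF : Nat.card F = (p ^ e) ^ 2) {j : Fin (2 * m)}
    (hj : (j : ℕ) ≤ m) :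
    orbitProduct (sylow F p e m) (X j) =
      ∏ᶠ b : orbitVectors F p e m j, (X j + ∑ l, b.1 l • X l : MvPolynomial (Fin (2 * m)) F) := by
  have hsingle (b : Fin (2 * m) → F) : ∑ l, (Pi.single j 1 + b : Fin (2 * m) → F) l • X l =
      (X j + ∑ l, b l • X l : MvPolynomial (Fin (2 * m)) F) := by
    simp [add_smul, Finset.sum_add_distrib, Pi.single_apply, ite_smul]
  have hset : {y | ∃ g ∈ sylow F p e m, polyAction F (2 * m) g (X j) = y} = Set.range
      fun b : orbitVectors F p e m j => (X j + ∑ l, b.1 l • X l : MvPolynomial (Fin (2 * m)) F) := by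
    ext y
    constructor
    · rintro ⟨g, hg, rfl⟩
      refine ⟨⟨_, row_mem_orbitVectors ((sylow F p e m).inv_mem hg) hj⟩, ?_⟩
      change X j + ∑ l, ((g⁻¹).1 j - Pi.single j 1 : Fin (2 * m) → F) l • X l = _
      rw [polyAction_X, ← hsingle, add_sub_cancel]
    · rintro ⟨⟨b, hb⟩, rfl⟩
      obtain ⟨N, hN, hrow⟩ := exists_mem_sylow_row_eq hF hj hb
      refine ⟨N⁻¹, (sylow F p e m).inv_mem hN, ?_⟩
      rw [polyAction_X, inv_inv, hrow, hsingle]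
  have hli : LinearIndependent F (X : Fin (2 * m) → MvPolynomial (Fin (2 * m)) F) :=
    (algebraicIndependent_X (Fin (2 * m)) F).linearIndependent
  have hinj := linearIndependent_iff_injective_fintypeLinearCombination.mp hli
  rw [orbitProduct, hset, finprod_mem_range]
  exact fun b b' hbb => Subtype.ext (hinj (add_left_cancel hbb))

theorem aeval_orbitProduct_X [Finite F] (hF : Nat.card F = (p ^ e) ^ 2) {R : Type*} [CommRing R]
    [Algebra F R] (x : Fin (2 * m) → R) {j : Fin (2 * m)} (hj : (j : ℕ) ≤ m) :
    aeval x (orbitProduct (sylow F p e m) (X j)) =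
      ∏ᶠ b : orbitVectors F p e m j, (x j + ∑ l, b.1 l • x l) := by
  have := Fintype.ofFinite (orbitVectors F p e m j)
  rw [orbitProduct_X hF hj, finprod_eq_prod_of_fintype, finprod_eq_prod_of_fintype]
  simp

theorem finprod_orbitVectors_zero {R : Type*} [CommRing R] [Algebra F R] (x : Fin (2 * m) → R)
    {j : Fin (2 * m)} (hj : (j : ℕ) = 0) :
    ∏ᶠ b : orbitVectors F p e m j, (x j + ∑ l, b.1 l • x l) = x j := by
  have h0 (b : orbitVectors F p e m j) : b = 0 :=
    Subtype.ext (funext fun l => b.2.1 l (by rw [Fin.le_def]; omega))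
  have : Unique (orbitVectors F p e m j) := ⟨⟨0⟩, h0⟩
  rw [finprod_unique, h0 default]
  simp

end Invariance

/-! ### Derivations vanishing on the generators -/

section Derivations

open MvPolynomial

variable {F L : Type*} [Field F] [Field L] [Algebra F L] {p e : ℕ} {m : ℕ}
  [Fact p.Prime] [CharP F p] [Finite F]

/-- A derivation that kills the generators kills all coordinates: the derivative of an additive
polynomial is a nonzero constant, which settles the first half of the coordinates and the one after
it, and the `h_k` then give a linear system with a Moore matrix for the other coordinates. -/
theorem derivation_eq_zero_of_generators (hF : Nat.card F = (p ^ e) ^ 2) (hm : 1 ≤ m)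
    {x : Fin (2 * m) → L} (hx : LinearIndependent F x) (D : Derivation F L L)
    (hN : ∀ j : Fin (2 * m), (j : ℕ) ≤ m →
      D (∏ᶠ b : orbitVectors F p e m j, (x j + ∑ l, b.1 l • x l)) = 0)
    (hh : ∀ k, 1 ≤ k → k ≤ m - 1 → D (aeval x (h F (p ^ e) m k)) = 0) (i : Fin (2 * m)) :
    D (x i) = 0 := by
  have := charP_of_injective_algebraMap (algebraMap F L).injective p
  have hlow : ∀ j : Fin (2 * m), (j : ℕ) ≤ m → D (x j) = 0 := by
    intro j
    induction j using WellFoundedLT.induction with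
    | ind j ih =>
      intro hj
      have := Fintype.ofFinite (orbitVectors F p e m j)
      have hD := hN j hj
      have hw (b : orbitVectors F p e m j) : D (∑ l, b.1 l • x l) = 0 := by
        rw [map_sum]
        refine Finset.sum_eq_zero fun l _ => ?_
        rcases lt_or_ge l j with hl | hl
        · rw [D.map_smul, ih l hl (by rw [Fin.lt_def] at hl; omega), smul_zero]
        · rw [b.2.1 l hl, zero_smul, map_zero]
      rw [finprod_eq_prod_of_fintype, derivation_prod_add D _ _ hw] at hD
      exact (smul_eq_zero.mp hD).resolve_left (eval_derivative_prod_X_add_ne_zero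
        (injective_linearCombination_orbitVectors hx j) (x j))
  obtain ⟨n, rfl⟩ : ∃ n, m = n + 1 := ⟨m - 1, by omega⟩
  have he : e ≠ 0 := by
    rintro rfl
    have h1 : 1 < Nat.card F := Finite.one_lt_card
    simp [hF] at h1
  -- The exponent is divisible by `p`, as `e ≠ 0`.
  have hpow (z : L) (k : ℕ) (hk : 1 ≤ k) : D (z ^ (p ^ e) ^ (2 * k - 1)) = 0 := by
    rw [D.leibniz_pow, ← Nat.cast_smul_eq_nsmul L]
    have : ((p ^ e) ^ (2 * k - 1) : ℕ) = (0 : L) := by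
      push_cast
      rw [CharP.cast_eq_zero, zero_pow he, zero_pow (by omega)]
    rw [this, zero_smul]
  let ι : Fin (n + 1) → Fin (2 * (n + 1)) := Fin.castLE (by omega)
  have hι (i) : (ι i : ℕ) = i := rfl
  have hlast : ((ι (Fin.last n)).rev : ℕ) = n + 1 := by rw [Fin.val_rev, hι, Fin.val_last]; omega
  have hv : LinearIndependent F fun i : Fin n => x (ι i.castSucc) ^ p ^ e :=
    linearIndependent_frobenius hF
      (hx.comp _ ((Fin.castLE_injective _).comp (Fin.castSucc_injective n)))
  have key : (fun i : Fin n => D (x (ι i.castSucc).rev)) = 0 := by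
    refine eq_zero_of_sum_mul_pow_eq_zero hv fun k => ?_
    have h1 := hh (k + 1) (by omega) (by omega)
    rw [aeval_h, map_sum, Fin.sum_univ_castSucc] at h1
    change ∑ i : Fin n, D (x (ι i.castSucc).rev ^ _ * x (ι i.castSucc) +
      x (ι i.castSucc).rev * x (ι i.castSucc) ^ _) + D (x (ι (Fin.last n)).rev ^ _ *
      x (ι (Fin.last n)) + x (ι (Fin.last n)).rev * x (ι (Fin.last n)) ^ _) = 0 at h1
    have hlowι (i) : D (x (ι i)) = 0 := hlow _ (by rw [hι]; omega)
    simp only [map_add, D.leibniz, hpow _ (k + 1) (by omega), hlowι, hlow _ hlast.le, mul_zero,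
      zero_add, add_zero, smul_eq_mul] at h1
    refine .trans ?_ h1
    refine Finset.sum_congr rfl fun i _ => ?_
    rw [hF, ← pow_mul (p ^ e) 2, ← pow_mul (x _), ← pow_succ' (p ^ e), mul_comm,
      show 2 * ((k : ℕ) + 1) - 1 = 2 * k + 1 by omega]
  by_cases hi : (i : ℕ) ≤ n + 1
  · exact hlow i hi
  · have hi' : i = (ι (Fin.castSucc ⟨i.rev, by rw [Fin.val_rev]; omega⟩)).rev := by
      rw [eq_rev_comm]; ext; rfl
    rw [hi']
    exact congrFun key _

end Derivations

/-! ### Separability and embeddings -/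

section Generation

open MvPolynomial

variable {F : Type*} [Field F]

theorem derivation_ratFunc_eq_zero {n : ℕ} (D : Derivation F (RatFunc F n) (RatFunc F n))
    (hD : ∀ i, D (algebraMap (MvPolynomial (Fin n) F) _ (X i)) = 0) : D = 0 := by
  have h0 : D.compAlgebraMap (MvPolynomial (Fin n) F) = 0 := derivation_ext fun i => by
    simpa using hD i
  have h1 (f : MvPolynomial (Fin n) F) : D (algebraMap _ _ f) = 0 := by
    simpa using congrArg (fun D => D f) h0
  ext z
  obtain ⟨a, b, -, rfl⟩ := IsFractionRing.div_surjective (MvPolynomial (Fin n) F) z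
  simp [D.leibniz_div, h1]

/-- Over a field `K` of rational functions for which every derivation of `F(V)` that vanishes on `K`
kills the coordinates, `F(V)` is separable algebraic: the module of Kähler differentials vanishes, and
`F(V)` is essentially of finite type. -/
theorem isSeparable_of_derivation {n : ℕ} (K : IntermediateField F (RatFunc F n))
    (hK : ∀ D : Derivation F (RatFunc F n) (RatFunc F n), (∀ z ∈ K, D z = 0) →
      ∀ i, D (algebraMap (MvPolynomial (Fin n) F) _ (X i)) = 0) :
    Algebra.IsSeparable K (RatFunc F n) := by
  have : Algebra.EssFiniteType (MvPolynomial (Fin n) F) (RatFunc F n) :=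
    Algebra.EssFiniteType.of_isLocalization _ (nonZeroDivisors (MvPolynomial (Fin n) F))
  have : Algebra.EssFiniteType F (RatFunc F n) :=
    Algebra.EssFiniteType.comp F (MvPolynomial (Fin n) F) (RatFunc F n)
  have : Algebra.EssFiniteType K (RatFunc F n) := Algebra.EssFiniteType.of_comp F K (RatFunc F n)
  rw [← Algebra.FormallyUnramified.iff_isSeparable]
  refine ⟨⟨fun a b => sub_eq_zero.mp ?_⟩⟩
  rw [← Module.forall_dual_apply_eq_zero_iff (RatFunc F n)]
  intro φ
  have hD : KaehlerDifferential.linearMapEquivDerivation K (RatFunc F n) φ = 0 := by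
    have h0 := derivation_ratFunc_eq_zero
      ((KaehlerDifferential.linearMapEquivDerivation K (RatFunc F n) φ).restrictScalars F)
      (hK _ fun z hz => Derivation.map_algebraMap
        (KaehlerDifferential.linearMapEquivDerivation K (RatFunc F n) φ) ⟨z, hz⟩)
    ext z
    exact congrArg (fun D => D z) h0
  rw [(LinearEquiv.map_eq_zero_iff _).mp hD, LinearMap.zero_apply]

/-- If all `K`-embeddings of a separable extension into an algebraic closure fix `z`, then `z`
belongs to `K`. -/
theorem mem_of_forall_algHom_eq {E : Type*} [Field E] [Algebra F E] (K : IntermediateField F E)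
    [Algebra.IsSeparable K E] {z : E}
    (hz : ∀ τ : E →ₐ[K] AlgebraicClosure E, τ z = algebraMap E _ z) : z ∈ K := by
  have halg : Algebra.IsAlgebraic K (AlgebraicClosure E) :=
    Algebra.IsAlgebraic.trans K E (AlgebraicClosure E)
  have : IsAlgClosure K (AlgebraicClosure E) := ⟨inferInstance, halg⟩
  have : Normal K (AlgebraicClosure E) := IsAlgClosure.normal K _
  by_contra hzK
  have hsep : IsSeparable K (algebraMap E (AlgebraicClosure E) z) :=
    (Algebra.IsSeparable.isSeparable K z).map (f := IsScalarTower.toAlgHom K E (AlgebraicClosure E))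
      (algebraMap E (AlgebraicClosure E)).injective
  have hbot : algebraMap E (AlgebraicClosure E) z ∉
      (⊥ : Subalgebra K (AlgebraicClosure E)) := by
    rintro ⟨w, hw⟩
    refine hzK ?_
    have : algebraMap E (AlgebraicClosure E) w = algebraMap E _ z := hw
    rw [← (algebraMap E (AlgebraicClosure E)).injective this]
    exact w.2
  obtain ⟨y, hne, hy⟩ := (notMem_iff_exists_ne_and_isConjRoot hsep
    (IsAlgClosed.splits _)).mp hbot
  obtain ⟨σ, hσ⟩ := hy.symm.exists_algEquiv
  exact hne (hσ ▸ (hz (σ.toAlgHom.comp (IsScalarTower.toAlgHom K E (AlgebraicClosure E)))).symm)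

end Generation

/-! ### The invariant field -/

section InvariantField

open MvPolynomial

variable {F : Type*} [Field F] {p e : ℕ} {m : ℕ} [Fact p.Prime] [CharP F p] [Finite F]

/-- A field of rational functions that contains the generators contains all invariants. -/
theorem invariantField_le (hF : Nat.card F = (p ^ e) ^ 2) (hm : 1 ≤ m)
    (K : IntermediateField F (RatFunc F (2 * m)))
    (hN : ∀ j : Fin (2 * m), (j : ℕ) ≤ m →
      algebraMap _ (RatFunc F (2 * m)) (orbitProduct (sylow F p e m) (X j)) ∈ K)
    (hh : ∀ k, 1 ≤ k → k ≤ m - 1 → algebraMap _ (RatFunc F (2 * m)) (h F (p ^ e) m k) ∈ K) :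
    invariantField (sylow F p e m) ≤ K := by
  let P := MvPolynomial (Fin (2 * m)) F
  let E := RatFunc F (2 * m)
  let x : Fin (2 * m) → E := fun i => algebraMap P E (X i)
  have haeval (f : P) : algebraMap P E f = aeval x f := by
    rw [← IsScalarTower.coe_toAlgHom' F P E]
    refine DFunLike.congr_fun (MvPolynomial.algHom_ext fun i => ?_ :
      IsScalarTower.toAlgHom F P E = aeval x) f
    rw [aeval_X]
    rfl
  have hx : AlgebraicIndependent F x :=
    (algebraicIndependent_X (Fin (2 * m)) F).map' (f := IsScalarTower.toAlgHom F P E)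
      (IsFractionRing.injective P E)
  have hsep : Algebra.IsSeparable K E := isSeparable_of_derivation K fun D hD =>
    derivation_eq_zero_of_generators hF hm hx.linearIndependent D
      (fun j hj => by
        rw [← aeval_orbitProduct_X hF x hj, ← haeval]
        exact hD _ (hN j hj))
      (fun k h1 h2 => by
        rw [← haeval]
        exact hD _ (hh k h1 h2))
  intro z hz
  rw [mem_invariantField_iff] at hz
  refine mem_of_forall_algHom_eq K fun τ => ?_
  let A := AlgebraicClosure E
  have hxA : AlgebraicIndependent F fun i => algebraMap E A (x i) :=
    hx.map' (f := IsScalarTower.toAlgHom F E A) (algebraMap E A).injective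
  have hyA : AlgebraicIndependent F fun i => τ (x i) :=
    hx.map' (f := τ.restrictScalars F) τ.injective
  have hτ (f : P) (hf : algebraMap P E f ∈ K) :
      aeval (fun i => τ (x i)) f = aeval (fun i => algebraMap E A (x i)) f := by
    have h1 : τ (algebraMap P E f) = algebraMap E A (algebraMap P E f) :=
      τ.commutes ⟨_, hf⟩
    rw [haeval] at h1
    have h2 : aeval (fun i => τ (x i)) f = τ (aeval x f) :=
      (comp_aeval_apply x (τ.restrictScalars F) f).symm
    have h3 : aeval (fun i => algebraMap E A (x i)) f = algebraMap E A (aeval x f) :=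
      (comp_aeval_apply x (IsScalarTower.toAlgHom F E A) f).symm
    rw [h2, h3, h1]
  obtain ⟨N, hNs, hNy⟩ := exists_mem_sylow_of_generators_eq hF hm hxA hyA.linearIndependent
    (fun j hj => by
      have := hτ _ (hN j hj)
      rwa [aeval_orbitProduct_X hF _ hj, aeval_orbitProduct_X hF _ hj] at this)
    (fun k h1 h2 => hτ _ (hh k h1 h2))
  have hact : (τ.restrictScalars F : E →ₐ[F] A) =
      (IsScalarTower.toAlgHom F E A).comp (fieldAction F (2 * m) N⁻¹).toAlgHom := by
    have hpoly : (τ.restrictScalars F : E →ₐ[F] A).comp (IsScalarTower.toAlgHom F P E) =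
        ((IsScalarTower.toAlgHom F E A).comp (fieldAction F (2 * m) N⁻¹).toAlgHom).comp
          (IsScalarTower.toAlgHom F P E) := by
      refine MvPolynomial.algHom_ext fun i => ?_
      change τ (x i) = algebraMap E A (fieldAction F (2 * m) N⁻¹ (algebraMap P E (X i)))
      rw [fieldAction_algebraMap, polyAction_X, inv_inv, hNy]
      simp only [map_sum, Algebra.smul_def, map_mul, ← IsScalarTower.algebraMap_apply]
      rfl
    refine AlgHom.ext fun w => ?_
    obtain ⟨a, b, -, rfl⟩ := IsFractionRing.div_surjective P w
    have ha := DFunLike.congr_fun hpoly a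
    have hb := DFunLike.congr_fun hpoly b
    simp only [AlgHom.comp_apply, IsScalarTower.coe_toAlgHom'] at ha hb ⊢
    rw [map_div₀, map_div₀, ha, hb, ← map_div₀, ← map_div₀]
  have := DFunLike.congr_fun hact z
  refine this.trans ?_
  change algebraMap E A (fieldAction F (2 * m) N⁻¹ z) = _
  rw [hz _ ((sylow F p e m).inv_mem hNs)]

theorem orbitProduct_X_zero (hF : Nat.card F = (p ^ e) ^ 2) (hm : 0 < 2 * m) :
    orbitProduct (sylow F p e m) (X ⟨0, hm⟩) = X ⟨0, hm⟩ := by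
  rw [orbitProduct_X hF (Nat.zero_le _), finprod_orbitVectors_zero X rfl]

end InvariantField

end SylowGU

theorem mainTheorem1 (p e : ℕ) [Fact p.Prime] (F : Type*) [Field F] [Finite F] [CharP F p]
    (hF : Nat.card F = (p ^ e) ^ 2) (m : ℕ) (hm : 1 ≤ m) :
    SylowGU.invariantField (SylowGU.sylow F p e m) =
      IntermediateField.adjoin F
        (algebraMap (MvPolynomial (Fin (2 * m)) F) (SylowGU.RatFunc F (2 * m)) ''
          ({MvPolynomial.X ⟨0, by omega⟩} ∪
            {f | ∃ j : Fin (2 * m), 1 ≤ (j : ℕ) ∧ (j : ℕ) ≤ m ∧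
              f = SylowGU.orbitProduct (SylowGU.sylow F p e m) (MvPolynomial.X j)} ∪
            {f | ∃ k : ℕ, 1 ≤ k ∧ k ≤ m - 1 ∧ f = SylowGU.h F (p ^ e) m k})) := by
  apply le_antisymm
  · refine SylowGU.invariantField_le hF hm _ (fun j hj => ?_) (fun k h1 h2 => ?_)
    · refine IntermediateField.subset_adjoin _ _ ⟨_, ?_, rfl⟩
      rcases Nat.eq_zero_or_pos (j : ℕ) with h0 | h0
      · have hj0 : j = ⟨0, by omega⟩ := Fin.ext h0
        rw [hj0]
        exact Or.inl (Or.inl (SylowGU.orbitProduct_X_zero hF _))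
      · exact Or.inl (Or.inr ⟨j, h0, hj, rfl⟩)
    · exact IntermediateField.subset_adjoin _ _ ⟨_, Or.inr ⟨k, h1, h2, rfl⟩, rfl⟩
  · rw [IntermediateField.adjoin_le_iff]
    rintro _ ⟨f, hf, rfl⟩
    rw [SetLike.mem_coe, SylowGU.mem_invariantField_iff]
    intro g hg
    rw [SylowGU.fieldAction_algebraMap]
    congr 1
    rcases hf with (rfl | ⟨j, -, -, rfl⟩) | ⟨k, hk, -, rfl⟩
    · exact SylowGU.polyAction_X_zero _ hg
    · exact SylowGU.polyAction_orbitProduct hg _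
    · exact SylowGU.polyAction_h hF hg hk
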